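/- Let $(A,\Psi)$ be a Hopf algebroid (a cogroupoid object in commutative rings, with units $\eta_L,\eta_R\colon A\to\Psi$) such that $\Psi$ is flat over $A$, and let $I\subseteq A$ be a finitely generated invariant ideal, i.e. $\eta_L(I)\Psi=\eta_R(I)\Psi$. Let $\mathrm{Comod}_\Psi$ be the category of left $\Psi$-comodules; tensor products are over $A$, and $\Psi\otimes N$ uses the right $A$-module structure of $\Psi$ and is an $A$-module through the left one. Write $C^I(N)=\lim_k N/I^kN$ for the $I$-adic completion of an $A$-module $N$, $N\widehat\otimes N'=C^I(N\otimes N')$, and $\widehat\Psi=C^I(\Psi)$. A complete comodule is an $I$-adically complete $A$-module $N$ with an $A$-linear, counitary and coassociative coaction $\widehat\psi_N\colon N\to\widehat\Psi\,\widehat\otimes\,N$. If $M$ is a $\Psi$-comodule with coaction $\psi_M$, then $C^I(M)$ is a complete comodule with coaction $C^I(M)\xrightarrow{C^I(\psi_M)}C^I(\Psi\otimes M)\cong\widehat\Psi\,\widehat\otimes\,C^I(M)$. For a complete comodule $N$, let $\iota'N$ be the pullback of $A$-modules of $$N\xrightarrow{\ \widehat\psi_N\ }\widehat\Psi\,\widehat\otimes\,N\xleftarrow{\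 j\ }\Psi\otimes N,$$ where $j$ is the canonical map, with projections $i\colon\iota'N\to N$ and $p\colon\iota'N\to\Psi\otimes N$. We say that $\iota'$ is defined on $N$ if $i$ is injective and $\iota'N$ has a $\Psi$-comodule structure $\rho\colon \iota'N\to\Psi\otimes\iota'N$ with $(1\otimes i)\rho=p$ (such a $\rho$ is unique); on these $N$, $\iota'$ is a functor to $\mathrm{Comod}_\Psi$. Theorem. Suppose that the canonical maps $$\Psi\otimes C^I(M)\to C^I(\Psi\otimes M)\qquad\text{and}\qquad \Psi\otimes C^I(\Psi\otimes M)\to C^I(\Psi\otimes\Psi\otimes M)$$ are injective for all $M\in\mathrm{Comod}_\Psi$. Then for every $M\in\mathrm{Comod}_\Psi$ the tower of comodules $(M\otimes A/I^k)_k$ has a limit $C^I_\Psi(M)=\lim_{\Psi,k}(M\otimes A/I^k)$ in $\mathrm{Comod}_\Psi$, the functor $\iota'$ is defined on $C^I(M)$, and the functors $C^I_\Psi$ and $\iota'C^I$ from $\mathrm{Comod}_\Psi$ to $\mathrm{Comod}_\Psi$ are naturally isomorphic. -/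

import Mathlib

open CategoryTheory TensorProduct

universe u

noncomputable section

/-! ### Biunital rings and the tensor products they define -/

/-- A commutative ring `B` with two ring homomorphisms `etaL etaR : A →+* B`, the left and the
right unit. Through them `B` is an `A`-`A`-bimodule. -/
structure BiunitalRing (A B : Type u) [CommRing A] [CommRing B] where
  /-- the left unit -/
  etaL : A →+* B
  /-- the right unit -/
  etaR : A →+* B

namespace BiunitalRing

variable {A B B' : Type u} [CommRing A] [CommRing B] [CommRing B']

/-- `B` as an `A`-algebra through the left unit. -/
def Left (_E : BiunitalRing A B) : Type u := B

/-- `B` as an `A`-algebra through the right unit. -/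
def Right (_E : BiunitalRing A B) : Type u := B

variable (E : BiunitalRing A B) (E' : BiunitalRing A B')

instance : CommRing E.Left := inferInstanceAs (CommRing B)

instance : CommRing E.Right := inferInstanceAs (CommRing B)

instance : Algebra A E.Left := RingHom.toAlgebra (S := E.Left) E.etaL

instance : Algebra A E.Right := RingHom.toAlgebra (S := E.Right) E.etaR

/-- The pure tensor `b ⊗ b'` in the ring `B ⊗_A B`, in which `b * etaR a ⊗ b'` is identified with
`b ⊗ etaL a * b'`. -/
def tmul₂ (b b' : B) : E.Right ⊗[A] E.Left :=
  TensorProduct.tmul A (M := E.Right) (N := E.Left) b b'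

theorem tmul₂_mul (b b' c c' : B) :
    E.tmul₂ b b' * E.tmul₂ c c' = E.tmul₂ (b * c) (b' * c') :=
  Algebra.TensorProduct.tmul_mul_tmul (A := E.Right) (B := E.Left) b c b' c'

theorem induction_on₂ {p : E.Right ⊗[A] E.Left → Prop} (t : E.Right ⊗[A] E.Left) (zero : p 0)
    (tmul : ∀ b b', p (E.tmul₂ b b')) (add : ∀ s t, p s → p t → p (s + t)) : p t :=
  TensorProduct.induction_on t zero tmul add

section Tens

variable (N : Type u) [AddCommGroup N] [Module A N]
variable {N' : Type u} [AddCommGroup N'] [Module A N']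
variable {X : Type u} [AddCommGroup X] [Module A X]

/-- The `A`-module `B ⊗_A N`: the tensor product is formed with the right `A`-module structure
of `B`, and `A` acts on it through the left `A`-module structure of `B`. -/
def Tens : Type u := E.Right ⊗[A] N

instance : AddCommGroup (E.Tens N) := inferInstanceAs (AddCommGroup (E.Right ⊗[A] N))

instance : Module E.Right (E.Tens N) := inferInstanceAs (Module E.Right (E.Right ⊗[A] N))

instance : Module A (E.Tens N) := Module.compHom (R := E.Right) _ (E.etaL : A →+* E.Right)

variable {N}

/-- The pure tensor `b ⊗ n`. -/
def tmul (b : B) (n : N) : E.Tens N := TensorProduct.tmul A (M := E.Right) b n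

theorem smul_tmul (a : A) (b : B) (n : N) : a • E.tmul b n = E.tmul (E.etaL a * b) n := rfl

theorem tmul_smul (a : A) (b : B) (n : N) : E.tmul b (a • n) = E.tmul (E.etaR a * b) n :=
  TensorProduct.tmul_smul (R := A) (M := E.Right) a b n

theorem tmul_add (b : B) (n n' : N) : E.tmul b (n + n') = E.tmul b n + E.tmul b n' :=
  TensorProduct.tmul_add (R := A) (M := E.Right) b n n'

theorem add_tmul (b b' : B) (n : N) : E.tmul (b + b') n = E.tmul b n + E.tmul b' n :=
  TensorProduct.add_tmul (R := A) (M := E.Right) b b' n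

theorem zero_tmul (n : N) : E.tmul 0 n = 0 :=
  map_zero ((TensorProduct.mk A E.Right N).flip n)

theorem tmul_zero (b : B) : E.tmul b (0 : N) = 0 :=
  map_zero (TensorProduct.mk A E.Right N b)

theorem induction_on {p : E.Tens N → Prop} (t : E.Tens N) (zero : p 0)
    (tmul : ∀ b n, p (E.tmul b n)) (add : ∀ s t, p s → p t → p (s + t)) : p t :=
  TensorProduct.induction_on (R := A) (M := E.Right) t zero tmul add

/-- The pure tensor as a biadditive map. -/
def tmulHom : B →+ N →+ E.Tens N where
  toFun b := { toFun := E.tmul b, map_zero' := E.tmul_zero b, map_add' := E.tmul_add b }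
  map_zero' := by ext n; exact E.zero_tmul n
  map_add' b b' := by ext n; exact E.add_tmul b b' n

/-- The additive map out of `B ⊗_A N` given by a biadditive map that is balanced over `A`. -/
def liftAdd (f : B →+ N →+ X) (hbal : ∀ a b n, f (E.etaR a * b) n = f b (a • n)) :
    E.Tens N →+ X :=
  TensorProduct.liftAddHom (R := A) (M := E.Right) f hbal

/-- The `A`-linear map out of `B ⊗_A N` given by a biadditive map that is balanced over `A` and
linear for the left `A`-module structure of `B`. -/
def lift (f : B →+ N →+ X) (hbal : ∀ a b n, f (E.etaR a * b) n = f b (a • n))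
    (hlin : ∀ a b n, f (E.etaL a * b) n = a • f b n) : E.Tens N →ₗ[A] X :=
  { E.liftAdd f hbal with
    map_smul' := fun a t => by
      change E.liftAdd f hbal (a • t) = a • E.liftAdd f hbal t
      induction t using E.induction_on with
      | zero => rw [smul_zero, map_zero, smul_zero]
      | tmul b n => exact hlin a b n
      | add s t hs ht => rw [smul_add, map_add, map_add, smul_add, hs, ht] }

@[simp] theorem lift_tmul (f : B →+ N →+ X) (hbal : ∀ a b n, f (E.etaR a * b) n = f b (a • n))
    (hlin : ∀ a b n, f (E.etaL a * b) n = a • f b n) (b : B) (n : N) :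
    E.lift f hbal hlin (E.tmul b n) = f b n := rfl

variable {E} in
theorem hom_ext {f g : E.Tens N →ₗ[A] X} (h : ∀ b n, f (E.tmul b n) = g (E.tmul b n)) :
    f = g := by
  ext t
  induction t using E.induction_on with
  | zero => rw [map_zero, map_zero]
  | tmul b n => exact h b n
  | add s t hs ht => rw [map_add, map_add, hs, ht]

/-- `1 ⊗ f : B ⊗_A N → B ⊗_A N'`. -/
def map (f : N →ₗ[A] N') : E.Tens N →ₗ[A] E.Tens N' :=
  { LinearMap.lTensor E.Right f with
    map_smul' := fun a t => (f.baseChange E.Right).map_smul (E.etaL a : E.Right) t }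

@[simp] theorem map_tmul (f : N →ₗ[A] N') (b : B) (n : N) :
    E.map f (E.tmul b n) = E.tmul b (f n) := rfl

theorem map_comp (g : N' →ₗ[A] X) (f : N →ₗ[A] N') :
    E.map (g ∘ₗ f) = E.map g ∘ₗ E.map f := hom_ext fun _ _ => rfl

theorem map_id : E.map (LinearMap.id : N →ₗ[A] N) = LinearMap.id := hom_ext fun _ _ => rfl

/-- `g ⊗ 1 : B ⊗_A N → B' ⊗_A N` for a ring homomorphism `g` compatible with the units. -/
def mapRing (g : B →+* B') (hL : ∀ a, g (E.etaL a) = E'.etaL a)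
    (hR : ∀ a, g (E.etaR a) = E'.etaR a) : E.Tens N →ₗ[A] E'.Tens N :=
  E.lift (E'.tmulHom.comp g.toAddMonoidHom)
    (fun a b n => by
      change E'.tmul (g (E.etaR a * b)) n = E'.tmul (g b) (a • n)
      rw [map_mul, hR, tmul_smul])
    (fun a b n => by
      change E'.tmul (g (E.etaL a * b)) n = a • E'.tmul (g b) n
      rw [map_mul, hL, smul_tmul])

/-- The `A`-linear map `B → B ⊗_A N`, `b ↦ b ⊗ n`. -/
def insert (n : N) : E.Left →ₗ[A] E.Tens N where
  toFun b := E.tmul b n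
  map_add' b b' := E.add_tmul b b' n
  map_smul' _ _ := rfl

/-- `ε ⊗ 1 : B ⊗_A N → A ⊗_A N = N`, `b ⊗ n ↦ ε(b) n`. -/
def counitTens (ε : B →+* A) (hL : ∀ a, ε (E.etaL a) = a) (hR : ∀ a, ε (E.etaR a) = a) :
    E.Tens N →ₗ[A] N :=
  E.lift
    { toFun := fun b => DistribSMul.toAddMonoidHom N (ε b)
      map_zero' := by ext n; simp
      map_add' := fun b b' => by ext n; simp [add_smul] }
    (fun a b n => by
      change ε (E.etaR a * b) • n = ε b • a • n
      rw [map_mul, hR, mul_comm, mul_smul])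
    (fun a b n => by
      change ε (E.etaL a * b) • n = a • ε b • n
      rw [map_mul, hL, mul_smul])

variable (N) in
/-- `Δ ⊗ 1 : B ⊗_A N → B ⊗_A (B ⊗_A N)`: if `Δ(b) = ∑ b' ⊗ b''` then
`b ⊗ n ↦ ∑ b' ⊗ (b'' ⊗ n)`. -/
def comulTens (Δ : B →+* E.Right ⊗[A] E.Left)
    (hL : ∀ a, Δ (E.etaL a) = E.tmul₂ (E.etaL a) 1)
    (hR : ∀ a, Δ (E.etaR a) = E.tmul₂ 1 (E.etaR a)) :
    E.Tens N →ₗ[A] E.Tens (E.Tens N) :=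
  E.lift
    (AddMonoidHom.mk'
      (fun b => AddMonoidHom.mk' (fun n => E.map (E.insert n) (show E.Tens E.Left from Δ b))
        (fun n n' => by
          generalize (show E.Tens E.Left from Δ b) = t
          induction t using E.induction_on with
          | zero => simp
          | tmul x y =>
            simp only [map_tmul]
            rw [← tmul_add]
            exact congrArg _ (E.tmul_add y n n')
          | add s t hs ht => simp only [map_add, hs, ht]; abel))
      (fun b b' => by
        ext n
        exact (congrArg (E.map (E.insert n)) (map_add Δ b b')).trans (map_add _ _ _)))
    (fun a b n => by
      change E.map (E.insert n) (show E.Tens E.Left from Δ (E.etaR a * b)) =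
        E.map (E.insert (a • n)) (show E.Tens E.Left from Δ b)
      rw [map_mul, hR]
      generalize Δ b = t
      induction t using E.induction_on₂ with
      | zero => rw [mul_zero]; exact (map_zero _).trans (map_zero _).symm
      | tmul x y =>
        rw [tmul₂_mul, one_mul]
        exact congrArg (E.tmul x) (E.tmul_smul a y n).symm
      | add s t hs ht =>
        rw [mul_add]
        exact ((map_add _ _ _).trans (congrArg₂ (· + ·) hs ht)).trans (map_add _ _ _).symm)
    (fun a b n => by
      change E.map (E.insert n) (show E.Tens E.Left from Δ (E.etaL a * b)) =
        a • E.map (E.insert n) (show E.Tens E.Left from Δ b)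
      rw [map_mul, hL, ← map_smul]
      congr 1
      generalize Δ b = t
      induction t using E.induction_on₂ with
      | zero => rw [mul_zero]; exact (smul_zero (A := E.Tens E.Left) a).symm
      | tmul x y => rw [tmul₂_mul, one_mul]; rfl
      | add s t hs ht =>
        rw [mul_add]
        exact (congrArg₂ (· + ·) hs ht).trans (smul_add (A := E.Tens E.Left) a s t).symm)

end Tens

/-- The additive map `B ⊗_A B → C`, `b ⊗ b' ↦ f(b) g(b')`, for ring homomorphisms `f, g : B → C`
with `f ∘ etaR = g ∘ etaL`. -/
def mulMap {C : Type u} [CommRing C] (f g : B →+* C) (h : ∀ a, f (E.etaR a) = g (E.etaL a)) :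
    E.Right ⊗[A] E.Left →+ C :=
  TensorProduct.liftAddHom (M := E.Right) (N := E.Left)
    (show B →+ B →+ C from (AddMonoidHom.mul.comp f.toAddMonoidHom).compl₂ g.toAddMonoidHom)
    (fun a (x y : B) => by
      change f (E.etaR a * x) * g y = f x * g (E.etaL a * y)
      rw [map_mul, map_mul, h]; ring)

/-! ### Invariant ideals and adic completion -/

/-- An ideal `I` of `A` is invariant if it generates the same ideal of `B` through both units,
that is `I B = B I`. -/
def IsInvariant (I : Ideal A) : Prop := I.map E.etaL = I.map E.etaR

variable {E} in
theorem IsInvariant.pow {I : Ideal A} (hI : E.IsInvariant I) (k : ℕ) : E.IsInvariant (I ^ k) := by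
  unfold IsInvariant at *
  rw [Ideal.map_pow, Ideal.map_pow, hI]

section Completion

variable (I : Ideal A)
variable {N : Type u} [AddCommGroup N] [Module A N]
variable {N' : Type u} [AddCommGroup N'] [Module A N']

theorem tmul_mem_of_mem_map {K : Ideal A} {b : B} (hb : b ∈ K.map E.etaL) (c : B) (n : N) :
    E.tmul (b * c) n ∈ (K • ⊤ : Submodule A (E.Tens N)) := by
  induction hb using Submodule.span_induction generalizing c with
  | mem b hb =>
    obtain ⟨a, ha, rfl⟩ := hb
    rw [← smul_tmul]
    exact Submodule.smul_mem_smul ha trivial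
  | zero => rw [zero_mul, zero_tmul]; exact zero_mem _
  | add x y _ _ hx hy => rw [add_mul, add_tmul]; exact add_mem (hx c) (hy c)
  | smul d x _ hx =>
    have : d • x * c = x * (d * c) := by rw [smul_eq_mul]; ring
    rw [this]; exact hx _

theorem tmul_mem_of_mem_smul {K : Ideal A} (hK : E.IsInvariant K) (b : B) {n : N}
    (hn : n ∈ (K • ⊤ : Submodule A N)) :
    E.tmul b n ∈ (K • ⊤ : Submodule A (E.Tens N)) := by
  induction hn using Submodule.smul_induction_on' with
  | smul a ha n _ =>
    rw [tmul_smul]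
    exact E.tmul_mem_of_mem_map (by rw [hK]; exact Ideal.mem_map_of_mem _ ha) b n
  | add x _ y _ hx hy => rw [tmul_add]; exact add_mem hx hy

/-- If `K` is invariant and kills `N`, then it kills `B ⊗_A N`. -/
theorem smul_eq_zero_of_invariant {K : Ideal A} (hK : E.IsInvariant K)
    (h : ∀ a ∈ K, ∀ n : N, a • n = 0) {a : A} (ha : a ∈ K) (t : E.Tens N) : a • t = 0 := by
  have key : ∀ b ∈ K.map E.etaR, ∀ (c : B) (n : N), E.tmul (b * c) n = 0 := by
    intro b hb
    induction hb using Submodule.span_induction with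
    | mem b hb =>
      obtain ⟨a, ha, rfl⟩ := hb
      intro c n
      rw [← tmul_smul, h a ha, tmul_zero]
    | zero => intro c n; rw [zero_mul, zero_tmul]
    | add x y _ _ hx hy => intro c n; rw [add_mul, add_tmul, hx, hy, add_zero]
    | smul d x _ hx =>
      intro c n
      have : d • x * c = x * (d * c) := by rw [smul_eq_mul]; ring
      rw [this, hx]
  induction t using E.induction_on with
  | zero => rw [smul_zero]
  | tmul b n => rw [smul_tmul]; exact key _ (hK ▸ Ideal.mem_map_of_mem _ ha) b n
  | add s t hs ht => rw [smul_add, hs, ht, add_zero]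

/-- The completion of a linear map, as an `A`-linear map. -/
abbrev cMap (f : N →ₗ[A] N') : AdicCompletion I N →ₗ[A] AdicCompletion I N' :=
  (AdicCompletion.map I f).restrictScalars A

variable (N) in
/-- The canonical map `B ⊗_A C^I(N) → C^I(B ⊗_A N)`; in degree `k` it sends `b ⊗ x` to the class of
`b ⊗ n`, where `n` is any representative of the image of `x` in `N / I^k N`. -/
def tensCompl {I : Ideal A} (hI : E.IsInvariant I) :
    E.Tens (AdicCompletion I N) →ₗ[A] AdicCompletion I (E.Tens N) :=
  let q (k : ℕ) (b : B) :
      (N ⧸ (I ^ k • ⊤ : Submodule A N)) →+ (E.Tens N ⧸ (I ^ k • ⊤ : Submodule A (E.Tens N))) :=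
    QuotientAddGroup.map (I ^ k • ⊤ : Submodule A N).toAddSubgroup
      (I ^ k • ⊤ : Submodule A (E.Tens N)).toAddSubgroup (E.tmulHom b)
      (fun _ hn => E.tmul_mem_of_mem_smul (hI.pow k) b hn)
  AdicCompletion.lift I
    (fun k => E.lift
      (AddMonoidHom.mk' (fun b => (q k b).comp (AdicCompletion.eval I N k).toAddMonoidHom)
        (fun b b' => by
          ext x
          change q k (b + b') (x.val k) = q k b (x.val k) + q k b' (x.val k)
          induction x.val k using Submodule.Quotient.induction_on with
          | _ n => exact congrArg Submodule.Quotient.mk (E.add_tmul b b' n)))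
      (fun a b x => by
        change q k (E.etaR a * b) (x.val k) = q k b (a • x.val k)
        induction x.val k using Submodule.Quotient.induction_on with
        | _ n => exact congrArg Submodule.Quotient.mk (E.tmul_smul a b n).symm)
      (fun a b x => by
        change q k (E.etaL a * b) (x.val k) = a • q k b (x.val k)
        induction x.val k using Submodule.Quotient.induction_on with
        | _ n => rfl))
    (fun {k l} hkl => by
      refine hom_ext fun b x => ?_
      change AdicCompletion.transitionMap I (E.Tens N) hkl (q l b (x.val l)) = q k b (x.val k)
      rw [← x.2 hkl]
      induction x.val l using Submodule.Quotient.induction_on with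
      | _ n => rfl)

/-- The completion of a biunital ring at `I`: the `I B`-adic completion of `B` with the induced
units. -/
def completion : BiunitalRing A (AdicCompletion (I.map E.etaL) B) where
  etaL := (algebraMap B _).comp E.etaL
  etaR := (algebraMap B _).comp E.etaR

variable (N) in
/-- The map `B ⊗_A N → B^ ⊗_A N` induced by `B → B^`, where `B^` is the completion of `B`. -/
def toHat : E.Tens N →ₗ[A] (E.completion I).Tens N :=
  E.mapRing (E.completion I) (algebraMap B _) (fun _ => rfl) (fun _ => rfl)

variable (N) in
/-- The biadditive map `B / I^k B × N → (B ⊗_A N) / I^k (B ⊗_A N)` induced by the pure tensors. -/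
def quotTmul (k : ℕ) : (B ⧸ ((I.map E.etaL) ^ k • ⊤ : Submodule B B)) →+
    N →+ (E.Tens N ⧸ (I ^ k • ⊤ : Submodule A (E.Tens N))) :=
  QuotientAddGroup.lift ((I.map E.etaL) ^ k • ⊤ : Submodule B B).toAddSubgroup
    (E.tmulHom.compr₂ (Submodule.mkQ (I ^ k • ⊤ : Submodule A (E.Tens N))).toAddMonoidHom)
    (fun b hb => by
      ext n
      refine (Submodule.Quotient.mk_eq_zero _).2 ?_
      have hb' : b ∈ (I ^ k).map E.etaL := by
        rw [Ideal.map_pow]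
        simpa using hb
      have := E.tmul_mem_of_mem_map hb' 1 n
      rwa [mul_one] at this)

variable (N) in
/-- The map `B^ ⊗_A N → (B ⊗_A N) / I^k (B ⊗_A N)` sending `x ⊗ n` to the class of `b ⊗ n`, where `b`
is any representative of the image of `x` in `B / I^k B`. -/
def hatLevel (k : ℕ) :
    (E.completion I).Tens N →ₗ[A] (E.Tens N ⧸ (I ^ k • ⊤ : Submodule A (E.Tens N))) :=
  (E.completion I).lift
    ((E.quotTmul I N k).comp (AdicCompletion.eval (I.map E.etaL) B k).toAddMonoidHom)
    (fun a x n => by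
      change E.quotTmul I N k (Submodule.Quotient.mk (E.etaR a) * x.val k) n =
        E.quotTmul I N k (x.val k) (a • n)
      induction x.val k using Submodule.Quotient.induction_on with
      | _ b => exact congrArg Submodule.Quotient.mk (E.tmul_smul a b n).symm)
    (fun a x n => by
      change E.quotTmul I N k (Submodule.Quotient.mk (E.etaL a) * x.val k) n =
        a • E.quotTmul I N k (x.val k) n
      induction x.val k using Submodule.Quotient.induction_on with
      | _ b => rfl)

theorem transitionMap_hatLevel {k l : ℕ} (hkl : k ≤ l) :
    AdicCompletion.transitionMap I (E.Tens N) hkl ∘ₗ E.hatLevel I N l = E.hatLevel I N k := by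
  refine hom_ext fun x n => ?_
  change AdicCompletion.transitionMap I (E.Tens N) hkl (E.quotTmul I N l (x.val l) n) =
    E.quotTmul I N k (x.val k) n
  rw [← x.2 hkl]
  induction x.val l using Submodule.Quotient.induction_on with
  | _ b => rfl

variable (N) in
/-- The map induced by `hatLevel` on the quotient by `I^k`. -/
def hatLevelQuot (k : ℕ) :
    ((E.completion I).Tens N ⧸ (I ^ k • ⊤ : Submodule A ((E.completion I).Tens N))) →ₗ[A]
      (E.Tens N ⧸ (I ^ k • ⊤ : Submodule A (E.Tens N))) :=
  Submodule.liftQ _ (E.hatLevel I N k) (by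
    rw [Submodule.smul_le]
    intro a ha t _
    rw [LinearMap.mem_ker, map_smul]
    induction E.hatLevel I N k t using Submodule.Quotient.induction_on with
    | _ s =>
      rw [← Submodule.Quotient.mk_smul, Submodule.Quotient.mk_eq_zero]
      exact Submodule.smul_mem_smul ha Submodule.mem_top)

variable (N) in
/-- The canonical identification `C^I(B^ ⊗_A N) → C^I(B ⊗_A N)` of completed tensor products. In
degree `k` it sends the class of `x ⊗ n` to the class of `b ⊗ n`, where `b` is any representative of
the image of `x` in `B / I^k B`. For a finitely generated ideal it is inverse to the completion of
`B ⊗_A N → B^ ⊗_A N`. -/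
def hatCompl :
    AdicCompletion I ((E.completion I).Tens N) →ₗ[A] AdicCompletion I (E.Tens N) :=
  AdicCompletion.lift I (fun k => E.hatLevelQuot I N k ∘ₗ AdicCompletion.eval I _ k)
    (fun {k l} hkl => by
      refine LinearMap.ext fun x => ?_
      simp only [LinearMap.comp_apply, AdicCompletion.eval_apply]
      rw [← x.2 hkl]
      induction x.val l using Submodule.Quotient.induction_on with
      | _ t => exact LinearMap.congr_fun (E.transitionMap_hatLevel I hkl) t)

theorem hatCompl_of_toHat (t : E.Tens N) :
    E.hatCompl I N (AdicCompletion.of I _ (E.toHat I N t)) = AdicCompletion.of I _ t := by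
  ext k
  induction t using E.induction_on with
  | zero => simp
  | tmul b n => rfl
  | add s t hs ht => simp only [map_add, AdicCompletion.val_add_apply, hs, ht]

theorem hatCompl_cMap_toHat (x : AdicCompletion I (E.Tens N)) :
    E.hatCompl I N (cMap I (E.toHat I N) x) = x := by
  ext k
  obtain ⟨t, ht⟩ := Submodule.Quotient.mk_surjective _ (x.val k)
  have h := congrArg (fun y => y.val k) (E.hatCompl_of_toHat I t)
  refine Eq.trans ?_ (h.trans ht)
  change E.hatLevelQuot I N k (LinearMap.reduceModIdeal (I ^ k) (E.toHat I N) (x.val k)) = _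
  rw [← ht]
  rfl

end Completion

end BiunitalRing

/-! ### Hopf algebroids and comodules -/

/-- A Hopf algebroid `(A, Ψ)`: a cogroupoid object in commutative rings. -/
structure HopfAlgebroid (A Ψ : Type u) [CommRing A] [CommRing Ψ] extends BiunitalRing A Ψ where
  /-- the composition `Δ : Ψ → Ψ ⊗_A Ψ` -/
  comul : Ψ →+* toBiunitalRing.Right ⊗[A] toBiunitalRing.Left
  /-- the identity `ε : Ψ → A` -/
  counit : Ψ →+* A
  /-- the inverse `c : Ψ → Ψ` -/
  antipode : Ψ →+* Ψ
  counit_etaL : ∀ a, counit (etaL a) = a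
  counit_etaR : ∀ a, counit (etaR a) = a
  comul_etaL : ∀ a, comul (etaL a) = toBiunitalRing.tmul₂ (etaL a) 1
  comul_etaR : ∀ a, comul (etaR a) = toBiunitalRing.tmul₂ 1 (etaR a)
  /-- `(1 ⊗ ε) Δ = 1` -/
  counit_right : ∀ x, toBiunitalRing.mulMap (RingHom.id Ψ) (etaR.comp counit)
    (fun a => congrArg etaR (counit_etaL a).symm) (comul x) = x
  /-- `(ε ⊗ 1) Δ = 1` -/
  counit_left : ∀ x, toBiunitalRing.mulMap (etaL.comp counit) (RingHom.id Ψ)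
    (fun a => congrArg etaL (counit_etaR a)) (comul x) = x
  /-- `(Δ ⊗ 1) Δ = (1 ⊗ Δ) Δ` -/
  coassoc : ∀ x,
    toBiunitalRing.comulTens toBiunitalRing.Left comul comul_etaL comul_etaR (comul x) =
      toBiunitalRing.map
        { toFun := comul
          map_add' := map_add comul
          map_smul' := fun a y => by
            refine (map_mul comul (etaL a) y).trans ?_
            rw [comul_etaL]
            generalize comul y = t
            induction t using toBiunitalRing.induction_on₂ with
            | zero => rw [mul_zero]; exact (smul_zero (A := toBiunitalRing.Tens _) a).symm
            | tmul x y => rw [toBiunitalRing.tmul₂_mul, one_mul]; rfl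
            | add s t hs ht =>
              rw [mul_add]
              exact (congrArg₂ (· + ·) hs ht).trans
                (smul_add (A := toBiunitalRing.Tens toBiunitalRing.Left) a s t).symm :
          toBiunitalRing.Left →ₗ[A] toBiunitalRing.Tens toBiunitalRing.Left } (comul x)
  antipode_etaL : ∀ a, antipode (etaL a) = etaR a
  antipode_etaR : ∀ a, antipode (etaR a) = etaL a
  antipode_antipode : ∀ x, antipode (antipode x) = x
  /-- `(c · 1) Δ = etaR ε` -/
  antipode_mul : ∀ x, toBiunitalRing.mulMap antipode (RingHom.id Ψ) antipode_etaR (comul x) =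
    etaR (counit x)
  /-- `(1 · c) Δ = etaL ε` -/
  mul_antipode : ∀ x, toBiunitalRing.mulMap (RingHom.id Ψ) antipode
    (fun a => (antipode_etaL a).symm) (comul x) = etaL (counit x)

namespace HopfAlgebroid

variable {A Ψ : Type u} [CommRing A] [CommRing Ψ] (H : HopfAlgebroid A Ψ)
variable (N : Type u) [AddCommGroup N] [Module A N]
variable {N' : Type u} [AddCommGroup N'] [Module A N']

/-- `ε ⊗ 1 : Ψ ⊗_A N → N`. -/
def counitMap : H.Tens N →ₗ[A] N :=
  H.toBiunitalRing.counitTens H.counit H.counit_etaL H.counit_etaR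

/-- `Δ ⊗ 1 : Ψ ⊗_A N → Ψ ⊗_A (Ψ ⊗_A N)`. -/
def comulMap : H.Tens N →ₗ[A] H.Tens (H.Tens N) :=
  H.toBiunitalRing.comulTens N H.comul H.comul_etaL H.comul_etaR

variable {N}

theorem counitMap_map (f : N →ₗ[A] N') :
    H.counitMap N' ∘ₗ H.map f = f ∘ₗ H.counitMap N :=
  BiunitalRing.hom_ext fun b n => (f.map_smul (H.counit b) n).symm

theorem comulMap_map (f : N →ₗ[A] N') :
    H.comulMap N' ∘ₗ H.map f = H.map (H.map f) ∘ₗ H.comulMap N :=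
  BiunitalRing.hom_ext fun b n => by
    change H.map (H.insert (f n)) (show H.Tens H.Left from H.comul b) =
      H.map (H.map f) (H.map (H.insert n) (show H.Tens H.Left from H.comul b))
    exact LinearMap.congr_fun
      (H.map_comp (H.map f) (H.insert n)) (show H.Tens H.Left from H.comul b)

theorem map_injective [Module.Flat A H.Left] {f : N →ₗ[A] N'} (hf : Function.Injective f) :
    Function.Injective (H.map f) := by
  let e : H.Right ≃ₗ[A] H.Left :=
    { toFun := H.antipode
      invFun := H.antipode
      left_inv := H.antipode_antipode
      right_inv := H.antipode_antipode
      map_add' := map_add H.antipode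
      map_smul' := fun a x => by
        refine (map_mul H.antipode (H.etaR a) x).trans ?_
        rw [H.antipode_etaR]
        rfl }
  have : Module.Flat A H.Right := Module.Flat.of_linearEquiv e
  exact Module.Flat.lTensor_preserves_injective_linearMap f hf

end HopfAlgebroid

/-- A (left) `Ψ`-comodule: an `A`-module with a counitary and coassociative coaction. -/
structure Comod {A Ψ : Type u} [CommRing A] [CommRing Ψ] (H : HopfAlgebroid A Ψ) where
  carrier : Type u
  [addCommGroup : AddCommGroup carrier]
  [module : Module A carrier]
  coact : carrier →ₗ[A] H.Tens carrier
  counit : H.counitMap carrier ∘ₗ coact = LinearMap.id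
  coassoc : H.comulMap carrier ∘ₗ coact = H.map coact ∘ₗ coact

attribute [instance] Comod.addCommGroup Comod.module

namespace Comod

variable {A Ψ : Type u} [CommRing A] [CommRing Ψ] {H : HopfAlgebroid A Ψ}

/-- A morphism of comodules. -/
@[ext]
structure Hom (M N : Comod H) where
  toLin : M.carrier →ₗ[A] N.carrier
  comm : N.coact ∘ₗ toLin = H.map toLin ∘ₗ M.coact

instance : Category (Comod H) where
  Hom := Hom
  id M := ⟨LinearMap.id, by rw [H.map_id]; rfl⟩
  comp f g := ⟨g.toLin ∘ₗ f.toLin, by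
    rw [← LinearMap.comp_assoc, g.comm, LinearMap.comp_assoc, f.comm, H.map_comp]; rfl⟩

theorem hom_ext {M N : Comod H} {f g : M ⟶ N} (h : Hom.toLin f = Hom.toLin g) : f = g :=
  Hom.ext h

/-- For an invariant ideal `K`, the comodule `M ⊗_A A/K = M / K M`. Its coaction sends the class of
`m` to the image of `ψ(m)` in `Ψ ⊗_A (M / K M)`. -/
def quot (M : Comod H) {K : Ideal A} (hK : H.IsInvariant K) : Comod H where
  carrier := M.carrier ⧸ (K • ⊤ : Submodule A M.carrier)
  coact := Submodule.liftQ _ (H.map (Submodule.mkQ _) ∘ₗ M.coact) (by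
    rw [Submodule.smul_le]
    intro a ha m _
    rw [LinearMap.mem_ker, map_smul]
    refine H.smul_eq_zero_of_invariant hK (fun a ha n => ?_) ha _
    induction n using Submodule.Quotient.induction_on with
    | _ n =>
      rw [← Submodule.Quotient.mk_smul, Submodule.Quotient.mk_eq_zero]
      exact Submodule.smul_mem_smul ha Submodule.mem_top)
  counit := by
    ext m
    have h1 := LinearMap.congr_fun
      (H.counitMap_map (Submodule.mkQ (K • ⊤ : Submodule A M.carrier))) (M.coact m)
    have h2 := LinearMap.congr_fun M.counit m
    exact h1.trans (congrArg Submodule.Quotient.mk h2)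
  coassoc := by
    ext m
    have h1 := LinearMap.congr_fun
      (H.comulMap_map (Submodule.mkQ (K • ⊤ : Submodule A M.carrier))) (M.coact m)
    have h2 := LinearMap.congr_fun M.coassoc m
    refine h1.trans ((congrArg _ h2).trans ?_)
    change (H.map (H.map _) ∘ₗ H.map M.coact) (M.coact m) =
      (H.map _ ∘ₗ H.map (Submodule.mkQ _)) (M.coact m)
    rw [← H.map_comp, ← H.map_comp]
    rfl

/-- The projection `M / K M → M / L M` for invariant ideals `K ≤ L`. -/
def quotProj (M : Comod H) {K L : Ideal A} (hK : H.IsInvariant K) (hL : H.IsInvariant L)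
    (h : K ≤ L) : M.quot hK ⟶ M.quot hL :=
  Hom.mk (Submodule.factor (Submodule.smul_mono_left h)) (by
    refine Submodule.linearMap_qext _ (LinearMap.ext fun m => ?_)
    change H.map (Submodule.mkQ _) (M.coact m) =
      (H.map _ ∘ₗ H.map (Submodule.mkQ _)) (M.coact m)
    rw [← H.map_comp]
    rfl)

/-- The morphism `M / K M → N / K N` induced by a morphism `M → N`. -/
def quotMap {M N : Comod H} (f : M ⟶ N) {K : Ideal A} (hK : H.IsInvariant K) :
    M.quot hK ⟶ N.quot hK :=
  Hom.mk (Submodule.mapQ _ _ (Hom.toLin f) (Submodule.smul_top_le_comap_smul_top K _)) (by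
    refine Submodule.linearMap_qext _ (LinearMap.ext fun m => ?_)
    change H.map (Submodule.mkQ _) (N.coact (Hom.toLin f m)) =
      (H.map _ ∘ₗ H.map (Submodule.mkQ _)) (M.coact m)
    rw [show N.coact (Hom.toLin f m) = H.map (Hom.toLin f) (M.coact m) from
      LinearMap.congr_fun (Hom.comm f) m]
    change (H.map (Submodule.mkQ _) ∘ₗ H.map (Hom.toLin f)) (M.coact m) = _
    rw [← H.map_comp, ← H.map_comp]
    rfl)

theorem comp_toLin {M N P : Comod H} (f : M ⟶ N) (g : N ⟶ P) :
    Hom.toLin (f ≫ g) = Hom.toLin g ∘ₗ Hom.toLin f := rfl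

theorem quotProj_self (M : Comod H) {K : Ideal A} (hK : H.IsInvariant K) (h : K ≤ K) :
    M.quotProj hK hK h = 𝟙 (M.quot hK) :=
  hom_ext (Submodule.linearMap_qext _ (LinearMap.ext fun _ => rfl))

theorem quotProj_comp (M : Comod H) {K L J : Ideal A} (hK : H.IsInvariant K)
    (hL : H.IsInvariant L) (hJ : H.IsInvariant J) (h : K ≤ L) (h' : L ≤ J) :
    M.quotProj hK hJ (h.trans h') = M.quotProj hK hL h ≫ M.quotProj hL hJ h' :=
  hom_ext (Submodule.linearMap_qext _ (LinearMap.ext fun _ => rfl))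

theorem quotProj_quotMap {M N : Comod H} (f : M ⟶ N) {K L : Ideal A} (hK : H.IsInvariant K)
    (hL : H.IsInvariant L) (h : K ≤ L) :
    M.quotProj hK hL h ≫ quotMap f hL = quotMap f hK ≫ N.quotProj hK hL h := by
  refine hom_ext (Submodule.linearMap_qext _ (LinearMap.ext fun m => ?_))
  rw [comp_toLin, comp_toLin]
  exact Eq.refl (Submodule.mkQ (L • ⊤ : Submodule A N.carrier) (Hom.toLin f m))

theorem quotMap_id (M : Comod H) {K : Ideal A} (hK : H.IsInvariant K) :
    quotMap (𝟙 M) hK = 𝟙 (M.quot hK) :=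
  hom_ext (Submodule.linearMap_qext _ (LinearMap.ext fun _ => rfl))

theorem quotMap_comp {M N P : Comod H} (f : M ⟶ N) (g : N ⟶ P) {K : Ideal A}
    (hK : H.IsInvariant K) : quotMap (f ≫ g) hK = quotMap f hK ≫ quotMap g hK :=
  hom_ext (Submodule.linearMap_qext _ (LinearMap.ext fun _ => rfl))

/-- The tower of comodules `⋯ → M ⊗_A A/I^2 → M ⊗_A A/I → M ⊗_A A/I^0`, as a functor of `M`. -/
def tower {I : Ideal A} (hI : H.IsInvariant I) : Comod H ⥤ ℕᵒᵖ ⥤ Comod H where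
  obj M :=
    { obj := fun k => M.quot (hI.pow k.unop)
      map := fun {k l} g => M.quotProj (hI.pow k.unop) (hI.pow l.unop)
        (Ideal.pow_le_pow_right (leOfHom g.unop))
      map_id := fun _ => M.quotProj_self _ _
      map_comp := fun _ _ => M.quotProj_comp _ _ _ _ _ }
  map f :=
    { app := fun k => quotMap f (hI.pow k.unop)
      naturality := fun k l g => quotProj_quotMap f (hI.pow k.unop) (hI.pow l.unop)
        (Ideal.pow_le_pow_right (leOfHom g.unop)) }
  map_id M := NatTrans.ext (funext fun _ => quotMap_id M _)
  map_comp f g := NatTrans.ext (funext fun _ => quotMap_comp f g _)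

/-- The comodule `I`-adic completion functor: the limit, in the category of comodules, of the tower
`M ⊗_A A/I^k`. -/
def adicCompletion {I : Ideal A} (hI : H.IsInvariant I)
    (hlim : ∀ M : Comod H, Limits.HasLimit ((tower hI).obj M)) : Comod H ⥤ Comod H where
  obj M := haveI := hlim M; Limits.limit ((tower hI).obj M)
  map {M N} f := haveI := hlim M; haveI := hlim N; Limits.limMap ((tower hI).map f)
  map_id M := by
    have := hlim M
    refine Limits.limit.hom_ext fun k => ?_
    rw [Limits.limMap_π, CategoryTheory.Functor.map_id]
    simp
  map_comp {M N P} f g := by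
    have := hlim M
    have := hlim N
    have := hlim P
    refine Limits.limit.hom_ext fun k => ?_
    rw [Limits.limMap_π, CategoryTheory.Functor.map_comp, Category.assoc, Limits.limMap_π,
      Limits.limMap_π_assoc]
    simp

end Comod

/-! ### Complete comodules -/

namespace HopfAlgebroid

variable {A Ψ : Type u} [CommRing A] [CommRing Ψ] (H : HopfAlgebroid A Ψ) (I : Ideal A)
variable (N : Type u) [AddCommGroup N] [Module A N]

/-- The completed tensor product `Ψ^ ⊗^ N = C^I(Ψ^ ⊗_A N)`, where `Ψ^ = C^I(Ψ)`. -/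
abbrev HatTens : Type u := AdicCompletion I ((H.completion I).Tens N)

/-- The canonical map `Ψ ⊗_A N → Ψ^ ⊗^ N`. -/
def toHatTens : H.Tens N →ₗ[A] H.HatTens I N := AdicCompletion.of I _ ∘ₗ H.toHat I N

/-- The map `ε^ ⊗^ 1 : Ψ^ ⊗^ N → C^I(N)` induced by the completion of `ε`: the completion of `ε ⊗ 1`,
after the identification of `Ψ^ ⊗^ N` with `C^I(Ψ ⊗_A N)`. -/
def hatCounit : H.HatTens I N →ₗ[A] AdicCompletion I N :=
  BiunitalRing.cMap I (H.counitMap N) ∘ₗ H.hatCompl I N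

/-- The map `Δ^ ⊗^ 1 : Ψ^ ⊗^ N → Ψ^ ⊗^ (Ψ^ ⊗^ N)` induced by the completion of `Δ`: the completion of
`Δ ⊗ 1 : Ψ ⊗_A N → Ψ ⊗_A (Ψ ⊗_A N)`, after the identification of `Ψ^ ⊗^ N` with `C^I(Ψ ⊗_A N)`,
followed by the completion of the canonical map `Ψ ⊗_A (Ψ ⊗_A N) → Ψ^ ⊗_A (Ψ^ ⊗^ N)`. -/
def hatComul : H.HatTens I N →ₗ[A] H.HatTens I (H.HatTens I N) :=
  BiunitalRing.cMap I (H.toHat I (H.HatTens I N) ∘ₗ H.map (H.toHatTens I N)) ∘ₗ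
    BiunitalRing.cMap I (H.comulMap N) ∘ₗ H.hatCompl I N

variable {N} {N' : Type u} [AddCommGroup N'] [Module A N']

/-- `1 ⊗^ f : Ψ^ ⊗^ N → Ψ^ ⊗^ N'`. -/
def hatMap (f : N →ₗ[A] N') : H.HatTens I N →ₗ[A] H.HatTens I N' :=
  BiunitalRing.cMap I ((H.completion I).map f)

end HopfAlgebroid

/-- A complete comodule: an `I`-adically complete `A`-module `N` with a counitary and coassociative
coaction `N → Ψ^ ⊗^ N` over the complete Hopf algebroid `Ψ^ = C^I(Ψ)`. -/
structure CompleteComod {A Ψ : Type u} [CommRing A] [CommRing Ψ] (H : HopfAlgebroid A Ψ)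
    (I : Ideal A) where
  carrier : Type u
  [addCommGroup : AddCommGroup carrier]
  [module : Module A carrier]
  [complete : IsAdicComplete I carrier]
  coact : carrier →ₗ[A] H.HatTens I carrier
  counit : H.hatCounit I carrier ∘ₗ coact = AdicCompletion.of I carrier
  coassoc : H.hatComul I carrier ∘ₗ coact = H.hatMap I coact ∘ₗ coact

attribute [instance] CompleteComod.addCommGroup CompleteComod.module CompleteComod.complete

namespace CompleteComod

variable {A Ψ : Type u} [CommRing A] [CommRing Ψ] {H : HopfAlgebroid A Ψ} {I : Ideal A}

theorem hatMap_comp {N N' N'' : Type u} [AddCommGroup N] [Module A N] [AddCommGroup N']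
    [Module A N'] [AddCommGroup N''] [Module A N''] (g : N' →ₗ[A] N'') (f : N →ₗ[A] N') :
    H.hatMap I (g ∘ₗ f) = H.hatMap I g ∘ₗ H.hatMap I f := by
  refine LinearMap.ext fun x => ?_
  simp only [HopfAlgebroid.hatMap, BiunitalRing.map_comp, LinearMap.comp_apply]
  exact (AdicCompletion.map_comp_apply I _ _ x).symm

/-- A morphism of complete comodules. -/
@[ext]
structure Hom (M N : CompleteComod H I) where
  toLin : M.carrier →ₗ[A] N.carrier
  comm : N.coact ∘ₗ toLin = H.hatMap I toLin ∘ₗ M.coact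

instance : Category (CompleteComod H I) where
  Hom := Hom
  id M := ⟨LinearMap.id, by
    refine LinearMap.ext fun m => ?_
    simp only [HopfAlgebroid.hatMap, BiunitalRing.map_id]
    exact (LinearMap.congr_fun (AdicCompletion.map_id I (M := (H.completion I).Tens M.carrier))
      (M.coact m)).symm⟩
  comp f g := ⟨g.toLin ∘ₗ f.toLin, by
    rw [← LinearMap.comp_assoc, g.comm, LinearMap.comp_assoc, f.comm, hatMap_comp]; rfl⟩

theorem hom_ext {M N : CompleteComod H I} {f g : M ⟶ N} (h : Hom.toLin f = Hom.toLin g) :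
    f = g :=
  Hom.ext h

theorem map_of_eq_of {N : Type u} [AddCommGroup N] [Module A N] (hfg : I.FG)
    (x : AdicCompletion I N) :
    AdicCompletion.map I (AdicCompletion.of I N) x = AdicCompletion.of I (AdicCompletion I N) x := by
  ext k
  obtain ⟨n, hn⟩ := Submodule.Quotient.mk_surjective _ (x.val k)
  rw [AdicCompletion.map_val_apply, ← hn]
  change Submodule.Quotient.mk (AdicCompletion.of I N n) = Submodule.Quotient.mk x
  rw [Submodule.Quotient.eq, AdicCompletion.pow_smul_top_eq_ker_eval hfg, LinearMap.mem_ker,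
    map_sub, AdicCompletion.eval_apply, AdicCompletion.eval_apply, ← hn, sub_eq_zero]
  rfl

theorem hatCompl_map_theta {N N' : Type u} [AddCommGroup N] [Module A N] [AddCommGroup N']
    [Module A N'] (f : N →ₗ[A] H.Tens N') (x : AdicCompletion I N) :
    H.hatCompl I _ (AdicCompletion.map I
      (H.toHat I (AdicCompletion I N') ∘ₗ H.map (AdicCompletion.of I N') ∘ₗ f) x) =
    AdicCompletion.map I (H.map (AdicCompletion.of I N') ∘ₗ f) x := by
  rw [← AdicCompletion.map_comp_apply]
  exact H.hatCompl_cMap_toHat I _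

theorem toHat_map {N N' : Type u} [AddCommGroup N] [Module A N] [AddCommGroup N'] [Module A N']
    (f : N →ₗ[A] N') :
    H.toHat I N' ∘ₗ H.map f = (H.completion I).map f ∘ₗ H.toHat I N :=
  BiunitalRing.hom_ext fun _ _ => rfl

/-- The coaction on `C^I(M)`: the completion of `ψ : M → Ψ ⊗_A M`, followed by the canonical map
`C^I(Ψ ⊗_A M) → Ψ^ ⊗^ C^I(M)`, that is the completion of the canonical map
`Ψ ⊗_A M → Ψ^ ⊗_A C^I(M)`. -/
def completeCoact (I : Ideal A) (M : Comod H) :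
    AdicCompletion I M.carrier →ₗ[A] H.HatTens I (AdicCompletion I M.carrier) :=
  BiunitalRing.cMap I
    (H.toHat I (AdicCompletion I M.carrier) ∘ₗ H.map (AdicCompletion.of I M.carrier)) ∘ₗ
    BiunitalRing.cMap I M.coact

theorem completeCoact_apply (M : Comod H) (x : AdicCompletion I M.carrier) :
    completeCoact I M x = AdicCompletion.map I
      (H.toHat I (AdicCompletion I M.carrier) ∘ₗ H.map (AdicCompletion.of I M.carrier) ∘ₗ
        M.coact) x :=
  AdicCompletion.map_comp_apply I _ _ x

/-- The `I`-adic completion of a comodule, as a complete comodule. -/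
def ofComod (hfg : I.FG) (M : Comod H) : CompleteComod H I where
  carrier := AdicCompletion I M.carrier
  complete := AdicCompletion.isAdicComplete hfg
  coact := completeCoact I M
  counit := by
    refine LinearMap.ext fun x => ?_
    rw [LinearMap.comp_apply, completeCoact_apply]
    change AdicCompletion.map I _ (H.hatCompl I _ _) = _
    rw [hatCompl_map_theta, AdicCompletion.map_comp_apply, ← LinearMap.comp_assoc,
      H.counitMap_map, LinearMap.comp_assoc, M.counit, LinearMap.comp_id, map_of_eq_of hfg]
  coassoc := by
    refine LinearMap.ext fun x => ?_
    rw [LinearMap.comp_apply, LinearMap.comp_apply, completeCoact_apply]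
    change AdicCompletion.map I _ (AdicCompletion.map I _ (H.hatCompl I _ _)) =
      AdicCompletion.map I _ _
    rw [hatCompl_map_theta, AdicCompletion.map_comp_apply, AdicCompletion.map_comp_apply,
      AdicCompletion.map_comp_apply]
    congr 2
    have h1 : completeCoact I M ∘ₗ AdicCompletion.of I M.carrier =
        H.toHatTens I (AdicCompletion I M.carrier) ∘ₗ H.map (AdicCompletion.of I M.carrier) ∘ₗ
          M.coact := by
      refine LinearMap.ext fun m => ?_
      rw [LinearMap.comp_apply, completeCoact_apply, AdicCompletion.map_of]
      rfl
    have h2 : H.map (completeCoact I M) ∘ₗ H.map (AdicCompletion.of I M.carrier) =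
        H.map (H.toHatTens I (AdicCompletion I M.carrier)) ∘ₗ
          H.map (H.map (AdicCompletion.of I M.carrier)) ∘ₗ H.map M.coact := by
      rw [← H.map_comp, h1, H.map_comp, H.map_comp]
    refine LinearMap.ext fun m => ?_
    have e1 := LinearMap.congr_fun (H.comulMap_map (AdicCompletion.of I M.carrier)) (M.coact m)
    have e2 := LinearMap.congr_fun M.coassoc m
    have e3 := LinearMap.congr_fun h2 (M.coact m)
    have e4 := LinearMap.congr_fun (toHat_map (I := I) (H := H) (completeCoact I M))
      (H.map (AdicCompletion.of I M.carrier) (M.coact m))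
    simp only [LinearMap.comp_apply] at e1 e2 e3 e4 ⊢
    rw [e1, e2, ← e3, e4]

theorem completeCoact_map (I : Ideal A) {M N : Comod H} (f : M ⟶ N) :
    completeCoact I N ∘ₗ BiunitalRing.cMap I (Comod.Hom.toLin f) =
      H.hatMap I (BiunitalRing.cMap I (Comod.Hom.toLin f)) ∘ₗ completeCoact I M := by
  refine LinearMap.ext fun (x : AdicCompletion I M.carrier) => ?_
  change completeCoact I N (AdicCompletion.map I (Comod.Hom.toLin f) x) =
    AdicCompletion.map I _ (completeCoact I M x)
  rw [completeCoact_apply, completeCoact_apply, AdicCompletion.map_comp_apply,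
    AdicCompletion.map_comp_apply]
  congr 2
  refine LinearMap.ext fun m => ?_
  have e1 := LinearMap.congr_fun (Comod.Hom.comm f) m
  have e2 := LinearMap.congr_fun (toHat_map (I := I) (H := H)
    (BiunitalRing.cMap I (Comod.Hom.toLin f)))
    (H.map (AdicCompletion.of I M.carrier) (M.coact m))
  have h : AdicCompletion.of I N.carrier ∘ₗ Comod.Hom.toLin f =
      BiunitalRing.cMap I (Comod.Hom.toLin f) ∘ₗ AdicCompletion.of I M.carrier :=
    LinearMap.ext fun m => (AdicCompletion.map_of I _ m).symm
  have e3 : H.map (AdicCompletion.of I N.carrier) (H.map (Comod.Hom.toLin f) (M.coact m)) =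
      H.map (BiunitalRing.cMap I (Comod.Hom.toLin f))
        (H.map (AdicCompletion.of I M.carrier) (M.coact m)) := by
    rw [← LinearMap.comp_apply, ← H.map_comp, h, H.map_comp, LinearMap.comp_apply]
  simp only [LinearMap.comp_apply] at e1 e2 ⊢
  rw [e1, e3, e2]

/-- The completion functor `C^I` from comodules to complete comodules. -/
def completionFunctor (H : HopfAlgebroid A Ψ) {I : Ideal A} (hfg : I.FG) :
    Comod H ⥤ CompleteComod H I where
  obj M := ofComod hfg M
  map f := Hom.mk (BiunitalRing.cMap I (Comod.Hom.toLin f)) (completeCoact_map I f)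
  map_id M := hom_ext (LinearMap.ext fun x =>
    LinearMap.congr_fun (AdicCompletion.map_id I (M := M.carrier)) x)
  map_comp f g := hom_ext (LinearMap.ext fun x =>
    (AdicCompletion.map_comp_apply I (Comod.Hom.toLin f) (Comod.Hom.toLin g) x).symm)

/-! ### The functor `ι'` -/

/-- The pullback `ι' N` of `N → Ψ^ ⊗^ N ← Ψ ⊗_A N`, where the first map is the coaction and the
second one is the canonical map. -/
def iota (N : CompleteComod H I) : Submodule A (N.carrier × H.Tens N.carrier) :=
  LinearMap.eqLocus (N.coact ∘ₗ LinearMap.fst A N.carrier (H.Tens N.carrier))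
    (H.toHatTens I N.carrier ∘ₗ LinearMap.snd A N.carrier (H.Tens N.carrier))

/-- The projection `i : ι' N → N`. -/
def iotaFst (N : CompleteComod H I) : N.iota →ₗ[A] N.carrier :=
  LinearMap.fst A N.carrier (H.Tens N.carrier) ∘ₗ N.iota.subtype

/-- The projection `p : ι' N → Ψ ⊗_A N`. -/
def iotaSnd (N : CompleteComod H I) : N.iota →ₗ[A] H.Tens N.carrier :=
  LinearMap.snd A N.carrier (H.Tens N.carrier) ∘ₗ N.iota.subtype

/-- The complete comodules `N` on which `ι'` is defined: `ι' N` is an `A`-submodule of `N` through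
`i`, and it is a comodule whose coaction `ρ` satisfies `(1 ⊗ i) ρ = p`. -/
def HasIota : ObjectProperty (CompleteComod H I) := fun N =>
  Function.Injective N.iotaFst ∧
    ∃ ρ : N.iota →ₗ[A] H.Tens N.iota,
      H.counitMap N.iota ∘ₗ ρ = LinearMap.id ∧
      H.comulMap N.iota ∘ₗ ρ = H.map ρ ∘ₗ ρ ∧
      H.map N.iotaFst ∘ₗ ρ = N.iotaSnd

/-- The comodule `ι' N`. -/
def iotaComod (N : CompleteComod H I) (h : HasIota N) : Comod H where
  carrier := N.iota
  coact := h.2.choose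
  counit := h.2.choose_spec.1
  coassoc := h.2.choose_spec.2.1

/-- The map `ι' N → ι' N'` induced by a morphism `N → N'` on the pullbacks. -/
def iotaMap {N N' : CompleteComod H I} (f : N ⟶ N') : N.iota →ₗ[A] N'.iota :=
  LinearMap.restrict (LinearMap.prodMap (Hom.toLin f) (H.map (Hom.toLin f))) (by
    rintro ⟨n, t⟩ (h : N.coact n = H.toHatTens I N.carrier t)
    change N'.coact (Hom.toLin f n) = H.toHatTens I N'.carrier (H.map (Hom.toLin f) t)
    have e1 := LinearMap.congr_fun (Hom.comm f) n
    have e2 := LinearMap.congr_fun (toHat_map (I := I) (H := H) (Hom.toLin f)) t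
    simp only [LinearMap.comp_apply] at e1 e2
    rw [e1, h, HopfAlgebroid.toHatTens, HopfAlgebroid.toHatTens, LinearMap.comp_apply,
      LinearMap.comp_apply, e2]
    exact AdicCompletion.map_of I _ _)

/-- The functor `ι'`, from the complete comodules on which it is defined to comodules. -/
def iotaFunctor (H : HopfAlgebroid A Ψ) [Module.Flat A H.Left] (I : Ideal A) :
    (HasIota (H := H) (I := I)).FullSubcategory ⥤ Comod H where
  obj N := iotaComod N.obj N.property
  map {N N'} f := Comod.Hom.mk (iotaMap f.hom) (by
    refine LinearMap.ext fun x => H.map_injective N'.property.1 ?_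
    have e1 := LinearMap.congr_fun N'.property.2.choose_spec.2.2 (iotaMap f.hom x)
    have e2 := LinearMap.congr_fun N.property.2.choose_spec.2.2 x
    have h : N'.obj.iotaFst ∘ₗ iotaMap f.hom = Hom.toLin f.hom ∘ₗ N.obj.iotaFst := rfl
    have e3 : H.map N'.obj.iotaFst (H.map (iotaMap f.hom) (N.property.2.choose x)) =
        H.map (Hom.toLin f.hom) (H.map N.obj.iotaFst (N.property.2.choose x)) := by
      rw [← LinearMap.comp_apply, ← H.map_comp, h, H.map_comp, LinearMap.comp_apply]
    refine e1.trans (Eq.trans ?_ e3.symm)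
    exact congrArg (H.map (Hom.toLin f.hom)) e2.symm)
  map_id N := Comod.hom_ext (LinearMap.ext fun x => Subtype.ext (Prod.ext rfl
    (LinearMap.congr_fun (H.map_id (N := N.obj.carrier)) x.1.2)))
  map_comp {N N' N''} f g := Comod.hom_ext (LinearMap.ext fun x => Subtype.ext (Prod.ext rfl
    (LinearMap.congr_fun (H.map_comp (Hom.toLin g.hom) (Hom.toLin f.hom)) x.1.2)))

end CompleteComod

end

/-!
The plan is to show that `ι' C^I(M)` itself, with the projections to the `M / I^k M`, is a limit of
the tower in comodules. Write `C = C^I` and `τ` for the canonical map `Ψ ⊗ C(N) → C(Ψ ⊗ N)`.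

Since `I` is finitely generated, the completed tensor product of `Ψ^` and `C(M)` is identified with
`C(Ψ ⊗ M)`, compatibly with `τ` (`complTens_injective`, `complTens_tensCompl`). Hence `ι' C(M)`
consists of the pairs `(x, t)` with `C(ψ)(x) = τ(t)` (`mem_iota_ofComod`), and as `τ` is injective
it is the submodule of those `x` in `C(M)` with `C(ψ)(x)` in the image of `τ`. By flatness,
`Ψ ⊗ ι' C(M)` is the kernel of the map from `Ψ ⊗ C(M)` to `Ψ ⊗ (C(Ψ ⊗ M) / im τ)` induced by
`C(ψ)`. That `t` lies in this kernel follows from `(1 ⊗ C(ψ)) t = (1 ⊗ τ) (Δ ⊗ 1) t`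
(`map_cMap_coact_iotaSnd`), which may be tested in `C(Ψ ⊗ Ψ ⊗ M)` by the second injectivity
hypothesis and is there the completed coassociativity of `M`. So `p` lifts to a coaction `ρ` with
`(1 ⊗ i) ρ = p`, and its axioms follow from injectivity of `1 ⊗ i` and `1 ⊗ 1 ⊗ i`
(`hasIota_ofComod`).

For the universal property, a cone over the tower with vertex `D` is a linear map `f : D → C(M)`
that is compatible with the coactions modulo each `I^k`. The map
`(Ψ ⊗ M) / I^k → Ψ ⊗ (M / I^k M)` is injective because `I` is invariant (`quotTens_injective`), so
`C(ψ) f = τ (1 ⊗ f) ψ_D`, which says that `f` factors through `ι' C(M)`.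
-/

/-! ### Completion and tensor products -/

namespace BiunitalRing

variable {A B : Type u} [CommRing A] [CommRing B] {E : BiunitalRing A B} {I : Ideal A}
variable {N : Type u} [AddCommGroup N] [Module A N]
variable {N' : Type u} [AddCommGroup N'] [Module A N']

theorem IsInvariant.completion {K : Ideal A} (hK : E.IsInvariant K) :
    (E.completion I).IsInvariant K := by
  change K.map ((algebraMap B _).comp E.etaL) = K.map ((algebraMap B _).comp E.etaR)
  rw [← Ideal.map_map, ← Ideal.map_map, hK]

theorem tensCompl_tmul_val (hI : E.IsInvariant I) (b : B) {x : AdicCompletion I N} {k : ℕ} {n : N}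
    (h : x.val k = Submodule.Quotient.mk n) :
    (E.tensCompl N hI (E.tmul b x)).val k = Submodule.Quotient.mk (E.tmul b n) := by
  change QuotientAddGroup.map (I ^ k • ⊤ : Submodule A N).toAddSubgroup
    (I ^ k • ⊤ : Submodule A (E.Tens N)).toAddSubgroup (E.tmulHom b)
    (fun _ hn => E.tmul_mem_of_mem_smul (hI.pow k) b hn) (x.val k) = _
  rw [h]
  rfl

theorem tensCompl_map (hI : E.IsInvariant I) (f : N →ₗ[A] N') :
    E.tensCompl N' hI ∘ₗ E.map (cMap I f) = cMap I (E.map f) ∘ₗ E.tensCompl N hI := by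
  refine hom_ext fun b x => AdicCompletion.ext fun k => ?_
  obtain ⟨n, hn⟩ := Submodule.Quotient.mk_surjective _ (x.val k)
  have h : (cMap I f x).val k = Submodule.Quotient.mk (f n) := by
    rw [LinearMap.restrictScalars_apply, AdicCompletion.map_val_apply, ← hn]
    rfl
  refine (tensCompl_tmul_val hI b h).trans ?_
  change _ = (AdicCompletion.map I (E.map f) (E.tensCompl N hI (E.tmul b x))).val k
  rw [AdicCompletion.map_val_apply, tensCompl_tmul_val hI b hn.symm]
  rfl

/-- The canonical map `(B ⊗_A N) / K (B ⊗_A N) → B ⊗_A (N / K N)` for an invariant ideal `K`. -/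
noncomputable def quotTens (E : BiunitalRing A B) (N : Type u) [AddCommGroup N] [Module A N]
    {K : Ideal A} (hK : E.IsInvariant K) :
    (E.Tens N ⧸ (K • ⊤ : Submodule A (E.Tens N))) →ₗ[A]
      E.Tens (N ⧸ (K • ⊤ : Submodule A N)) :=
  Submodule.liftQ _ (E.map (Submodule.mkQ _)) (by
    rw [Submodule.smul_le]
    intro a ha t _
    rw [LinearMap.mem_ker, map_smul]
    refine E.smul_eq_zero_of_invariant hK (fun a ha n => ?_) ha _
    induction n using Submodule.Quotient.induction_on with
    | _ n =>
      rw [← Submodule.Quotient.mk_smul, Submodule.Quotient.mk_eq_zero]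
      exact Submodule.smul_mem_smul ha Submodule.mem_top)

theorem quotTens_injective {K : Ideal A} (hK : E.IsInvariant K) :
    Function.Injective (E.quotTens N hK) := by
  rw [injective_iff_map_eq_zero]
  intro t ht
  induction t using Submodule.Quotient.induction_on with
  | _ t =>
    have hex := lTensor_exact E.Right
      (LinearMap.exact_subtype_mkQ (K • ⊤ : Submodule A N)) (Submodule.mkQ_surjective _)
    obtain ⟨s, rfl⟩ := (hex t).1 ht
    refine (Submodule.Quotient.mk_eq_zero _).2 ?_
    clear ht
    change E.map (Submodule.subtype _) (show E.Tens (K • ⊤ : Submodule A N) from s) ∈ _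
    generalize (show E.Tens (K • ⊤ : Submodule A N) from s) = s
    induction s using E.induction_on with
    | zero => rw [map_zero]; exact zero_mem _
    | tmul b n => exact E.tmul_mem_of_mem_smul hK b n.2
    | add s t hs ht => rw [map_add]; exact add_mem hs ht

theorem quotTens_tensCompl (hI : E.IsInvariant I) (k : ℕ) (t : E.Tens (AdicCompletion I N)) :
    E.quotTens N (hI.pow k) ((E.tensCompl N hI t).val k) =
      E.map (AdicCompletion.eval I N k) t := by
  induction t using E.induction_on with
  | zero => simp
  | tmul b x =>
    obtain ⟨n, hn⟩ := Submodule.Quotient.mk_surjective _ (x.val k)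
    rw [tensCompl_tmul_val hI b hn.symm, map_tmul, AdicCompletion.eval_apply, ← hn]
    rfl
  | add s t hs ht => simp only [map_add, AdicCompletion.val_add_apply, hs, ht]

/-- The completion of `B ⊗_A N → B^ ⊗_A C^I(N)`. For an invariant finitely generated ideal it
identifies `C^I(B ⊗_A N)` with the completed tensor product of `B^` and `C^I(N)`. -/
noncomputable def complTens (E : BiunitalRing A B) (I : Ideal A) (N : Type u) [AddCommGroup N]
    [Module A N] :
    AdicCompletion I (E.Tens N) →ₗ[A]
      AdicCompletion I ((E.completion I).Tens (AdicCompletion I N)) :=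
  cMap I (E.toHat I (AdicCompletion I N) ∘ₗ E.map (AdicCompletion.of I N))

theorem complTens_injective (hI : E.IsInvariant I) :
    Function.Injective (E.complTens I N) := by
  refine (injective_iff_map_eq_zero _).2 fun y hy => AdicCompletion.ext fun k => ?_
  have h1 : AdicCompletion.map I (E.map (AdicCompletion.of I N)) y = 0 := by
    have h := E.hatCompl_cMap_toHat I (AdicCompletion.map I (E.map (AdicCompletion.of I N)) y)
    rw [← h, LinearMap.restrictScalars_apply, AdicCompletion.map_comp_apply]
    exact (congrArg _ hy).trans (map_zero _)
  obtain ⟨t, ht⟩ := Submodule.Quotient.mk_surjective _ (y.val k)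
  have h2 : E.map (AdicCompletion.of I N) t ∈
      (I ^ k • ⊤ : Submodule A (E.Tens (AdicCompletion I N))) := by
    have := congrArg (fun z => z.val k) h1
    simp only [AdicCompletion.map_val_apply, ← ht] at this
    exact (Submodule.Quotient.mk_eq_zero _).1 this
  -- applying `tensCompl` and evaluating in degree `k` recovers the class of `t`
  have h3 : ∀ s : E.Tens N, (E.tensCompl N hI (E.map (AdicCompletion.of I N) s)).val k =
      Submodule.Quotient.mk s := fun s => by
    induction s using E.induction_on with
    | zero => simp
    | tmul b n => exact tensCompl_tmul_val hI b rfl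
    | add s t hs ht => simp only [map_add, AdicCompletion.val_add_apply, hs, ht]; rfl
  have h4 := Submodule.smul_top_le_comap_smul_top (I ^ k)
    (AdicCompletion.eval I (E.Tens N) k ∘ₗ E.tensCompl N hI) h2
  rw [← ht, ← h3]
  refine (Submodule.mem_bot A).1 (?_ : _ ∈ (⊥ : Submodule A _))
  refine (Submodule.smul_le.2 ?_ : (I ^ k • ⊤ : Submodule A _) ≤ ⊥) h4
  intro a ha s _
  induction s using Submodule.Quotient.induction_on with
  | _ s =>
    rw [← Submodule.Quotient.mk_smul, Submodule.mem_bot, Submodule.Quotient.mk_eq_zero]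
    exact Submodule.smul_mem_smul ha Submodule.mem_top

/-- Composed with the identification `complTens`, the map `B ⊗_A C^I(N) → C^I(B ⊗_A N)` is the
canonical map from the tensor product to the completed one. -/
theorem complTens_tensCompl (hfg : I.FG) (hI : E.IsInvariant I)
    (t : E.Tens (AdicCompletion I N)) :
    E.complTens I N (E.tensCompl N hI t) = AdicCompletion.of I _ (E.toHat I _ t) := by
  refine AdicCompletion.ext fun k => ?_
  induction t using E.induction_on with
  | zero => simp
  | tmul b x =>
    obtain ⟨n, hn⟩ := Submodule.Quotient.mk_surjective _ (x.val k)
    change (AdicCompletion.map I _ _).val k = _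
    rw [AdicCompletion.map_val_apply, tensCompl_tmul_val hI b hn.symm]
    change Submodule.Quotient.mk ((E.completion I).tmul (algebraMap B _ b)
      (AdicCompletion.of I N n)) = Submodule.Quotient.mk
        ((E.completion I).tmul (algebraMap B _ b) x)
    rw [Submodule.Quotient.eq]
    have h := map_sub ((E.completion I).tmulHom (N := AdicCompletion I N) (algebraMap B _ b))
      (AdicCompletion.of I N n) x
    change (E.completion I).tmul _ _ = (E.completion I).tmul _ _ - (E.completion I).tmul _ _ at h
    rw [← h]
    -- as `I` is finitely generated, elements of `C^I(N)` that agree in degree `k` are congruent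
    -- modulo `I ^ k`
    refine tmul_mem_of_mem_smul _ (IsInvariant.completion (hI.pow k)) _ ?_
    rw [AdicCompletion.pow_smul_top_eq_ker_eval hfg, LinearMap.mem_ker, map_sub,
      AdicCompletion.eval_apply, AdicCompletion.eval_apply, ← hn, sub_eq_zero]
    rfl
  | add s t hs ht => simp only [map_add, AdicCompletion.val_add_apply, hs, ht]

end BiunitalRing

namespace HopfAlgebroid

variable {A Ψ : Type u} [CommRing A] [CommRing Ψ] {H : HopfAlgebroid A Ψ} {I : Ideal A}
variable {N : Type u} [AddCommGroup N] [Module A N]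
variable {N' : Type u} [AddCommGroup N'] [Module A N']

theorem cMap_counitMap_tensCompl (hI : H.IsInvariant I) :
    BiunitalRing.cMap I (H.counitMap N) ∘ₗ H.tensCompl N hI =
      H.counitMap (AdicCompletion I N) := by
  refine BiunitalRing.hom_ext fun b x => AdicCompletion.ext fun k => ?_
  obtain ⟨n, hn⟩ := Submodule.Quotient.mk_surjective _ (x.val k)
  change (AdicCompletion.map I _ _).val k = (H.counit b • x).val k
  rw [AdicCompletion.map_val_apply, BiunitalRing.tensCompl_tmul_val hI b hn.symm,
    AdicCompletion.val_smul_apply, ← hn]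
  rfl

/-- Compatibility of the canonical map `Ψ ⊗_A C^I(N) → C^I(Ψ ⊗_A N)` with the comultiplication. -/
theorem tensCompl_comulMap (hI : H.IsInvariant I) :
    H.tensCompl (H.Tens N) hI ∘ₗ H.map (H.tensCompl N hI) ∘ₗ
        H.comulMap (AdicCompletion I N) =
      BiunitalRing.cMap I (H.comulMap N) ∘ₗ H.tensCompl N hI := by
  refine BiunitalRing.hom_ext fun b x => AdicCompletion.ext fun k => ?_
  obtain ⟨n, hn⟩ := Submodule.Quotient.mk_surjective _ (x.val k)
  change _ = (AdicCompletion.map I _ _).val k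
  rw [AdicCompletion.map_val_apply, BiunitalRing.tensCompl_tmul_val hI b hn.symm]
  change (H.tensCompl (H.Tens N) hI (H.map (H.tensCompl N hI)
      (H.map (H.insert x) (show H.Tens H.Left from H.comul b)))).val k =
    Submodule.Quotient.mk (H.map (H.insert n) (show H.Tens H.Left from H.comul b))
  generalize (show H.Tens H.Left from H.comul b) = t
  induction t using H.induction_on with
  | zero => simp
  | tmul b c =>
    exact BiunitalRing.tensCompl_tmul_val hI b (BiunitalRing.tensCompl_tmul_val hI c hn.symm)
  | add s t hs ht => simp only [map_add, AdicCompletion.val_add_apply, hs, ht]; rfl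

theorem map_exact [Module.Flat A H.Left] {N'' : Type u} [AddCommGroup N''] [Module A N'']
    {f : N →ₗ[A] N'} {g : N' →ₗ[A] N''} (h : Function.Exact f g) :
    Function.Exact (H.map f) (H.map g) := by
  have : Module.Flat A H.Right :=
    Module.Flat.iff_lTensor_preserves_injective_linearMap.2
      fun _ _ _ _ _ _ _ hf => H.map_injective hf
  exact Module.Flat.lTensor_exact H.Right h

end HopfAlgebroid

/-! ### The pullback on completions of comodules -/

namespace CompleteComod

variable {A Ψ : Type u} [CommRing A] [CommRing Ψ] {H : HopfAlgebroid A Ψ} {I : Ideal A}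

/-- The pullback defining `ι' C^I(M)` may be formed over `C^I(Ψ ⊗_A M)` instead of `Ψ^ ⊗^ C^I(M)`. -/
theorem mem_iota_ofComod (hfg : I.FG) (hI : H.IsInvariant I) (M : Comod H)
    {x : AdicCompletion I M.carrier} {t : H.Tens (AdicCompletion I M.carrier)} :
    ((x, t) : (ofComod hfg M).carrier × H.Tens (ofComod hfg M).carrier) ∈ (ofComod hfg M).iota ↔
      BiunitalRing.cMap I M.coact x = H.tensCompl M.carrier hI t := by
  rw [← (BiunitalRing.complTens_injective hI).eq_iff, BiunitalRing.complTens_tensCompl hfg hI]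
  exact Iff.rfl

theorem cMap_coact_iotaFst (hfg : I.FG) (hI : H.IsInvariant I) (M : Comod H)
    (z : (ofComod hfg M).iota) :
    BiunitalRing.cMap I M.coact ((ofComod hfg M).iotaFst z) =
      H.tensCompl M.carrier hI ((ofComod hfg M).iotaSnd z) :=
  (mem_iota_ofComod hfg hI M).1 z.2

theorem iotaFst_ofComod_injective (hfg : I.FG) (hI : H.IsInvariant I) (M : Comod H)
    (h₁ : Function.Injective (H.tensCompl M.carrier hI)) :
    Function.Injective (ofComod hfg M).iotaFst := by
  intro z w h
  refine Subtype.ext (Prod.ext h (h₁ ?_))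
  exact (cMap_coact_iotaFst hfg hI M z).symm.trans
    ((congrArg _ h).trans (cMap_coact_iotaFst hfg hI M w))

theorem counitMap_iotaSnd (hfg : I.FG) (hI : H.IsInvariant I) (M : Comod H)
    (z : (ofComod hfg M).iota) :
    H.counitMap (AdicCompletion I M.carrier) ((ofComod hfg M).iotaSnd z) =
      (ofComod hfg M).iotaFst z := by
  refine (LinearMap.congr_fun (HopfAlgebroid.cMap_counitMap_tensCompl hI) _).symm.trans ?_
  refine (congrArg (BiunitalRing.cMap I (H.counitMap M.carrier))
    (cMap_coact_iotaFst hfg hI M z).symm).trans ?_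
  refine (AdicCompletion.map_comp_apply I _ _ _).trans ?_
  rw [M.counit]
  exact LinearMap.congr_fun (AdicCompletion.map_id I (M := M.carrier)) _

/-- Coassociativity of `M` in `Ψ ⊗_A C^I(Ψ ⊗_A M)`. This follows from coassociativity in
`C^I(Ψ ⊗_A Ψ ⊗_A M)` by injectivity of the canonical map. -/
theorem map_cMap_coact_iotaSnd (hfg : I.FG) (hI : H.IsInvariant I) (M : Comod H)
    (h₂ : Function.Injective (H.tensCompl (H.Tens M.carrier) hI)) (z : (ofComod hfg M).iota) :
    H.map (BiunitalRing.cMap I M.coact) ((ofComod hfg M).iotaSnd z) =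
      H.map (H.tensCompl M.carrier hI)
        (H.comulMap (AdicCompletion I M.carrier) ((ofComod hfg M).iotaSnd z)) := by
  apply h₂
  have e1 := LinearMap.congr_fun (BiunitalRing.tensCompl_map hI M.coact)
    ((ofComod hfg M).iotaSnd z)
  have e2 := LinearMap.congr_fun (HopfAlgebroid.tensCompl_comulMap (N := M.carrier) hI)
    ((ofComod hfg M).iotaSnd z)
  refine e1.trans (Eq.trans ?_ e2.symm)
  change BiunitalRing.cMap I (H.map M.coact) (H.tensCompl M.carrier hI _) =
    BiunitalRing.cMap I (H.comulMap M.carrier) (H.tensCompl M.carrier hI _)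
  rw [← cMap_coact_iotaFst hfg hI M z]
  refine (AdicCompletion.map_comp_apply I _ _ _).trans
    (Eq.trans ?_ (AdicCompletion.map_comp_apply I _ _ _).symm)
  rw [M.coassoc]

/-- The projection `p` takes values in the submodule `Ψ ⊗_A ι' C^I(M)` of `Ψ ⊗_A C^I(M)`. Since
`ι' C^I(M)` is the kernel of `C^I(M) → C^I(Ψ ⊗_A M) / (Ψ ⊗_A C^I(M))`, flatness reduces this to
coassociativity. -/
theorem iotaSnd_mem_range [Module.Flat A H.Left] (hfg : I.FG) (hI : H.IsInvariant I) (M : Comod H)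
    (h₂ : Function.Injective (H.tensCompl (H.Tens M.carrier) hI)) (z : (ofComod hfg M).iota) :
    (ofComod hfg M).iotaSnd z ∈ LinearMap.range (H.map (ofComod hfg M).iotaFst) := by
  let q := Submodule.mkQ (LinearMap.range (H.tensCompl M.carrier hI))
  have hex : Function.Exact (ofComod hfg M).iotaFst (q ∘ₗ BiunitalRing.cMap I M.coact) := by
    intro (x : AdicCompletion I M.carrier)
    change (Submodule.Quotient.mk (BiunitalRing.cMap I M.coact x) = 0) ↔ _
    rw [Submodule.Quotient.mk_eq_zero]
    constructor
    · rintro ⟨t, ht⟩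
      exact ⟨⟨(x, t), (mem_iota_ofComod hfg hI M).2 ht.symm⟩, rfl⟩
    · rintro ⟨z, rfl⟩
      exact ⟨_, (cMap_coact_iotaFst hfg hI M z).symm⟩
  refine (HopfAlgebroid.map_exact hex _).1 ?_
  refine (LinearMap.congr_fun (H.map_comp q (BiunitalRing.cMap I M.coact)) _).trans ?_
  refine (congrArg (H.map q) (map_cMap_coact_iotaSnd hfg hI M h₂ z)).trans ?_
  refine (LinearMap.congr_fun (H.map_comp q (H.tensCompl M.carrier hI)) _).symm.trans ?_
  have : q ∘ₗ H.tensCompl M.carrier hI = 0 := LinearMap.range_mkQ_comp _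
  rw [this]
  generalize H.comulMap (AdicCompletion I M.carrier) ((ofComod hfg M).iotaSnd z) = s
  induction s using H.induction_on with
  | zero => exact map_zero _
  | tmul b n => exact H.tmul_zero b
  | add s t hs ht => rw [map_add, hs, ht, add_zero]

theorem hasIota_ofComod [Module.Flat A H.Left] (hfg : I.FG) (hI : H.IsInvariant I) (M : Comod H)
    (h₁ : Function.Injective (H.tensCompl M.carrier hI))
    (h₂ : Function.Injective (H.tensCompl (H.Tens M.carrier) hI)) :
    HasIota (ofComod hfg M) := by
  have hi := iotaFst_ofComod_injective hfg hI M h₁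
  have hi' := H.map_injective hi
  let ρ : (ofComod hfg M).iota →ₗ[A] H.Tens (ofComod hfg M).iota :=
    (LinearEquiv.ofInjective _ hi').symm.toLinearMap ∘ₗ
      LinearMap.codRestrict _ (ofComod hfg M).iotaSnd (iotaSnd_mem_range hfg hI M h₂)
  have hρ : ∀ z, H.map (ofComod hfg M).iotaFst (ρ z) = (ofComod hfg M).iotaSnd z := fun z =>
    LinearEquiv.ofInjective_symm_apply (h := hi') _ ⟨_, iotaSnd_mem_range hfg hI M h₂ z⟩
  -- `(1 ⊗ p) ρ = (Δ ⊗ 1) p`, compared in `Ψ ⊗_A C^I(Ψ ⊗_A M)`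
  have hρ' : ∀ z, H.map (ofComod hfg M).iotaSnd (ρ z) =
      H.comulMap (AdicCompletion I M.carrier) ((ofComod hfg M).iotaSnd z) := fun z => by
    apply H.map_injective h₁
    refine Eq.trans ?_ (map_cMap_coact_iotaSnd hfg hI M h₂ z)
    refine Eq.trans ?_ (congrArg _ (hρ z))
    refine (LinearMap.congr_fun (H.map_comp _ _) _).symm.trans
      (Eq.trans ?_ (LinearMap.congr_fun (H.map_comp _ _) _))
    congr 2
    exact LinearMap.ext fun w => (cMap_coact_iotaFst hfg hI M w).symm
  refine ⟨hi, ρ, LinearMap.ext fun z => hi ?_, LinearMap.ext fun z => ?_, LinearMap.ext hρ⟩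
  · refine (LinearMap.congr_fun (H.counitMap_map (ofComod hfg M).iotaFst) (ρ z)).symm.trans ?_
    exact (congrArg _ (hρ z)).trans (counitMap_iotaSnd hfg hI M z)
  · apply H.map_injective hi'
    refine (LinearMap.congr_fun (H.comulMap_map (ofComod hfg M).iotaFst) (ρ z)).symm.trans ?_
    refine (congrArg _ (hρ z)).trans ((hρ' z).symm.trans ?_)
    refine Eq.trans ?_ (LinearMap.congr_fun (H.map_comp _ _) _)
    congr 2
    exact LinearMap.ext fun w => (hρ w).symm

theorem map_iotaFst_coact {N : CompleteComod H I} (h : HasIota N) (z : N.iota) :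
    H.map N.iotaFst ((iotaComod N h).coact z) = N.iotaSnd z :=
  LinearMap.congr_fun h.2.choose_spec.2.2 z

/-! ### The limit of the tower -/

theorem quotTens_cMap_coact (hI : H.IsInvariant I) (M : Comod H) (k : ℕ)
    (x : AdicCompletion I M.carrier) :
    H.quotTens M.carrier (hI.pow k) ((BiunitalRing.cMap I M.coact x).val k) =
      (M.quot (hI.pow k)).coact (x.val k) := by
  rw [LinearMap.restrictScalars_apply, AdicCompletion.map_val_apply]
  induction x.val k using Submodule.Quotient.induction_on with
  | _ n => rfl

/-- The projection `ι' C^I(M) → C^I(M) → M / I^k M`. -/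
noncomputable def iotaProj (hfg : I.FG) (hI : H.IsInvariant I) (M : Comod H)
    (h : HasIota (ofComod hfg M)) (k : ℕ) : iotaComod (ofComod hfg M) h ⟶ M.quot (hI.pow k) :=
  Comod.Hom.mk (AdicCompletion.eval I M.carrier k ∘ₗ (ofComod hfg M).iotaFst) (by
    refine LinearMap.ext fun z => ?_
    have e1 := congrArg (H.map (AdicCompletion.eval I M.carrier k)) (map_iotaFst_coact h z)
    have e2 := LinearMap.congr_fun (H.map_comp (AdicCompletion.eval I M.carrier k)
      (ofComod hfg M).iotaFst) ((iotaComod (ofComod hfg M) h).coact z)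
    refine Eq.trans ?_ (e1.symm.trans e2.symm)
    refine Eq.trans ?_ (BiunitalRing.quotTens_tensCompl hI k _)
    rw [← cMap_coact_iotaFst hfg hI M z]
    exact (quotTens_cMap_coact hI M k _).symm)

/-- The cone over the tower `M / I^k M` with vertex `ι' C^I(M)`. -/
noncomputable def iotaCone (hfg : I.FG) (hI : H.IsInvariant I) (M : Comod H)
    (h : HasIota (ofComod hfg M)) : Limits.Cone ((Comod.tower hI).obj M) where
  pt := iotaComod (ofComod hfg M) h
  π :=
    { app := fun k => iotaProj hfg hI M h k.unop
      naturality := fun k l g => by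
        refine (Category.id_comp _).trans (Comod.hom_ext (LinearMap.ext fun z => ?_))
        exact (((ofComod hfg M).iotaFst z).2 (leOfHom g.unop)).symm }

/-- The linear map `D → C^I(M)` given by a cone over the tower with vertex `D`. -/
noncomputable def coneToCompletion (hI : H.IsInvariant I) {M : Comod H}
    (s : Limits.Cone ((Comod.tower hI).obj M)) : s.pt.carrier →ₗ[A] AdicCompletion I M.carrier :=
  AdicCompletion.lift I (fun k => Comod.Hom.toLin (s.π.app (Opposite.op k))) (fun hkl =>
    congrArg Comod.Hom.toLin (s.w (homOfLE hkl).op))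

/-- Compatibility with the coactions holds in every degree because the components of a cone are
comodule morphisms. -/
theorem cMap_coact_coneToCompletion (hI : H.IsInvariant I) {M : Comod H}
    (s : Limits.Cone ((Comod.tower hI).obj M)) (d : s.pt.carrier) :
    BiunitalRing.cMap I M.coact (coneToCompletion hI s d) =
      H.tensCompl M.carrier hI (H.map (coneToCompletion hI s) (s.pt.coact d)) := by
  refine AdicCompletion.ext fun k => BiunitalRing.quotTens_injective (hI.pow k) ?_
  rw [BiunitalRing.quotTens_tensCompl]
  refine Eq.trans ?_ ((LinearMap.congr_fun (Comod.Hom.comm (s.π.app (Opposite.op k))) d).trans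
    (LinearMap.congr_fun (H.map_comp (AdicCompletion.eval I M.carrier k)
      (coneToCompletion hI s)) (s.pt.coact d)))
  exact quotTens_cMap_coact hI M k _

/-- The morphism `D → ι' C^I(M)` given by a cone over the tower with vertex `D`. -/
noncomputable def coneToIota [Module.Flat A H.Left] (hfg : I.FG) (hI : H.IsInvariant I)
    {M : Comod H} (h : HasIota (ofComod hfg M)) (s : Limits.Cone ((Comod.tower hI).obj M)) :
    s.pt ⟶ iotaComod (ofComod hfg M) h :=
  let g : s.pt.carrier →ₗ[A] (ofComod hfg M).iota := LinearMap.codRestrict (ofComod hfg M).iota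
    (LinearMap.prod (coneToCompletion hI s) (H.map (coneToCompletion hI s) ∘ₗ s.pt.coact))
    (fun d => (mem_iota_ofComod hfg hI M).2 (cMap_coact_coneToCompletion hI s d))
  Comod.Hom.mk g (by
    refine LinearMap.ext fun d => H.map_injective h.1 ?_
    refine (map_iotaFst_coact h (g d)).trans ?_
    exact LinearMap.congr_fun (H.map_comp (ofComod hfg M).iotaFst g) (s.pt.coact d))

/-- `ι' C^I(M)` is the limit of the tower `M / I^k M` in the category of comodules. -/
noncomputable def isLimitIotaCone [Module.Flat A H.Left] (hfg : I.FG) (hI : H.IsInvariant I)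
    (M : Comod H) (h : HasIota (ofComod hfg M)) : Limits.IsLimit (iotaCone hfg hI M h) where
  lift s := coneToIota hfg hI h s
  fac s k := Comod.hom_ext (LinearMap.ext fun d => rfl)
  uniq s m hm := by
    refine Comod.hom_ext (LinearMap.ext fun d => h.1 (AdicCompletion.ext fun k => ?_))
    exact LinearMap.congr_fun (congrArg Comod.Hom.toLin (hm (Opposite.op k))) d

end CompleteComod

theorem mainTheorem5 {A Ψ : Type u} [CommRing A] [CommRing Ψ] (H : HopfAlgebroid A Ψ)
    [Module.Flat A H.Left] (I : Ideal A) (hfg : I.FG) (hI : H.IsInvariant I)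
    (h₁ : ∀ M : Comod H, Function.Injective (H.tensCompl M.carrier hI))
    (h₂ : ∀ M : Comod H, Function.Injective (H.tensCompl (H.Tens M.carrier) hI)) :
    ∃ (hlim : ∀ M : Comod H, Limits.HasLimit ((Comod.tower hI).obj M))
      (hι : ∀ M : Comod H,
        CompleteComod.HasIota ((CompleteComod.completionFunctor H hfg).obj M)),
      Nonempty (Comod.adicCompletion hI hlim ≅
        CompleteComod.HasIota.lift (CompleteComod.completionFunctor H hfg) hι ⋙
          CompleteComod.iotaFunctor H I) := by
  have hι (M : Comod H) : CompleteComod.HasIota (CompleteComod.ofComod hfg M) :=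
    CompleteComod.hasIota_ofComod hfg hI M (h₁ M) (h₂ M)
  have hlim (M : Comod H) : Limits.HasLimit ((Comod.tower hI).obj M) :=
    ⟨⟨_, CompleteComod.isLimitIotaCone hfg hI M (hι M)⟩⟩
  refine ⟨hlim, hι, ⟨(NatIso.ofComponents (fun M => haveI := hlim M
    Limits.IsLimit.conePointUniqueUpToIso (CompleteComod.isLimitIotaCone hfg hI M (hι M))
      (Limits.limit.isLimit ((Comod.tower hI).obj M))) fun {M N} f => ?_).symm⟩⟩
  have := hlim M
  have := hlim N
  -- naturality is checked on the projections to `N / I^k N`, where both sides are induced by `f`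
  refine Limits.limit.hom_ext fun k => ?_
  have e (M : Comod H) [Limits.HasLimit ((Comod.tower hI).obj M)] :=
    Limits.IsLimit.conePointUniqueUpToIso_hom_comp
      (CompleteComod.isLimitIotaCone hfg hI M (hι M))
      (Limits.limit.isLimit ((Comod.tower hI).obj M)) k
  refine (Category.assoc _ _ _).trans ((congrArg _ (e N)).trans ?_)
  refine Eq.trans ?_ (Category.assoc _ _ _).symm
  refine Eq.trans ?_ (congrArg _ (Limits.limMap_π _ k).symm)
  refine Eq.trans ?_ (Category.assoc _ _ _)
  refine Eq.trans ?_ (congrArg (· ≫ _) (e M).symm)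
  refine Comod.hom_ext (LinearMap.ext fun z => ?_)
  exact AdicCompletion.map_val_apply I _ _
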